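/- **Theorem 4.2 (Kantorovich–Rubinstein for kernels).** Let $(\Omega,\mathscr F,P)$ be a probability space and let $(\mathbb X,\mathbf d)$ be a metric space whose topology is Polish, with its Borel $\sigma$-field. A probability kernel from $\Omega$ to a measurable space $S$ is a family $(\mu_\omega)_{\omega\in\Omega}$ of probability measures on $S$ such that $\omega\mapsto\mu_\omega(B)$ is $\mathscr F$-measurable for every measurable $B\subset S$. Let $\mathscr K_1(\mathbb X)$ be the set of probability kernels $\mu$ from $\Omega$ to $\mathbb X$ with $\mathbb E\int_{\mathbb X}\mathbf d(x,x_0)\,\mu_\omega(\mathrm dx)<\infty$ for some $x_0\in\mathbb X$. For $\mu,\nu\in\mathscr K_1(\mathbb X)$ let $\mathcal K(\mu,\nu)$ be the set of probability kernels $\pi$ from $\Omega$ to $\mathbb X\times\mathbb X$ such that, for every $\omega$, $\pi_\omega$ has first marginal $\mu_\omega$ and second marginal $\nu_\omega$, and put $$\mathcal W_1(\mu,\nu):=\inf_{\pi\in\mathcal K(\mu,\nu)}\mathbb E\int_{\mathbb X\times\mathbb X}\mathbf d(x,y)\,\pi_\omega(\mathrm dx,\mathrm dy).$$ Then, for all $\mu,\nu\in\mathscr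 K_1(\mathbb X)$, $\mathcal W_1(\mu,\nu)$ is finite and $$\mathcal W_1(\mu,\nu)=\sup_{\psi}\ \mathbb E\left(\int_{\mathbb X}\psi(\omega,x)\,\nu_\omega(\mathrm dx)-\int_{\mathbb X}\psi(\omega,x)\,\mu_\omega(\mathrm dx)\right),$$ where the supremum is over all jointly measurable functions $\psi:\Omega\times\mathbb X\to\mathbb R$ such that $|\psi(\omega,x)-\psi(\omega,x')|\le\mathbf d(x,x')$ for all $\omega\in\Omega$ and $x,x'\in\mathbb X$. For every such $\psi$, the two inner integrals exist (as integrals of integrable functions) for $P$-almost every $\omega$, and their difference is $P$-integrable. -/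

import Mathlib

open MeasureTheory ProbabilityTheory
open scoped ENNReal NNReal

namespace KernelTransport

/-- `𝓚(μ, ν)`: the probability kernels from `Ω` to `X × Y` whose marginal kernels are `μ` and `ν`
(for every `ω`). -/
def couplings {Ω X Y : Type*} [MeasurableSpace Ω] [MeasurableSpace X] [MeasurableSpace Y]
    (μ : Kernel Ω X) (ν : Kernel Ω Y) : Set (Kernel Ω (X × Y)) :=
  {π | IsMarkovKernel π ∧ π.fst = μ ∧ π.snd = ν}

/-- `𝒦_p(X)`: the probability kernels `μ` from `Ω` to `X` with
`𝔼 ∫ d(x, x₀)^p μ_ω(dx) < ∞` for some `x₀ ∈ X`. -/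
def kernelSpace {Ω X : Type*} [MeasurableSpace Ω] [MetricSpace X] [MeasurableSpace X]
    (p : ℝ) (P : Measure Ω) : Set (Kernel Ω X) :=
  {μ | IsMarkovKernel μ ∧ ∃ x₀ : X, ∫⁻ ω, ∫⁻ x, edist x x₀ ^ p ∂(μ ω) ∂P < ∞}

/-- The `p`-Wasserstein distance between probability kernels,
`(inf_{π ∈ 𝓚(μ, ν)} 𝔼 ∫ d(x, y)^p π_ω(dx, dy))^{1/p}`, as an element of `[0, ∞]`. -/
noncomputable def wasserstein {Ω X : Type*} [MeasurableSpace Ω] [MetricSpace X]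
    [MeasurableSpace X] (p : ℝ) (P : Measure Ω) (μ ν : Kernel Ω X) : ℝ≥0∞ :=
  (⨅ π ∈ couplings μ ν, ∫⁻ ω, ∫⁻ z, edist z.1 z.2 ^ p ∂(π ω) ∂P) ^ (1 / p)

/-- Jointly measurable real functions `ψ(ω, x)` with `‖ψ(ω, ·)‖_Lip ≤ 1` for every `ω`. -/
def lipOne (Ω X : Type*) [MeasurableSpace Ω] [MetricSpace X] [MeasurableSpace X] :
    Set (Ω → X → ℝ) :=
  {ψ | Measurable (Function.uncurry ψ) ∧ ∀ ω, LipschitzWith 1 (ψ ω)}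

end KernelTransport

/-! Weak duality holds fibrewise: for a coupling `π` and a 1-Lipschitz `ψ ω`, the difference of the
two integrals is the `π ω`-integral of `ψ ω y - ψ ω x`, which is at most the transport cost
(`enorm_integral_sub_le_of_mem_couplings`).

For the converse one needs a nearly optimal coupling and a nearly optimal potential, both measurable
in `ω`. A simple function `T`, the same for all `ω`, moves points by an arbitrarily small distance
in mean under both kernels. Replacing `x` by `T x` reduces each fibre to weights on a finite set,
where Hahn–Banach gives duality (`exists_potentials`, `exists_plan_lipschitz`). Measurability comes
from a countable choice: near-optimizers are fixed at a dense sequence of weight pairs, every other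
pair uses the first sufficiently close member, and the borrowed plan is repaired to have exactly the
right marginals (`isPlan_repairPlan`, `sum_mul_repairPlan_le`). The finite plan is lifted to a
coupling of the original kernels by a density, constant on products of fibres of `T`, against the
product kernel (`exists_mem_couplings_lift`). The triangle inequality then undoes the quantization
on both the primal and the dual side. -/

namespace KernelTransport

/-! ### Duality on finitely many points -/

section FiniteDuality

variable {ι X : Type*} [Fintype ι]

/-- `p` is a transport plan between the weight vectors `a` and `b`. -/
structure IsPlan (a b : ι → ℝ) (p : ι → ι → ℝ) : Prop where
  nonneg : ∀ i j, 0 ≤ p i j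
  row : ∀ i, ∑ j, p i j = a i
  col : ∀ j, ∑ i, p i j = b j

theorem isPlan_mul {a b : ι → ℝ} (ha : a ∈ stdSimplex ℝ ι) (hb : b ∈ stdSimplex ℝ ι) :
    IsPlan a b (fun i j => a i * b j) where
  nonneg i j := mul_nonneg (ha.1 i) (hb.1 j)
  row i := by rw [← Finset.mul_sum, hb.2, mul_one]
  col j := by rw [← Finset.sum_mul, ha.2, one_mul]

/-- A minimum of 1-Lipschitz functions is 1-Lipschitz. This transform of `φ` lets a single function
replace a pair of dual potentials. -/
theorem lipschitzWith_iInf_dist_sub [MetricSpace X] [Nonempty ι] (e : ι → X) (φ : ι → ℝ) :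
    LipschitzWith 1 (fun x => ⨅ i, (dist x (e i) - φ i)) := by
  refine LipschitzWith.of_le_add fun x y => ?_
  obtain ⟨i, hi⟩ := exists_eq_ciInf_of_finite (f := fun i => dist y (e i) - φ i)
  have h := ciInf_le (Set.finite_range (fun i => dist x (e i) - φ i)).bddBelow i
  have := dist_triangle x y (e i)
  linarith

/-- The cost and the two marginals of a matrix, as a linear map. -/
noncomputable def costMarginals (c : ι → ι → ℝ) :
    (ι × ι → ℝ) →ₗ[ℝ] ℝ × (ι → ℝ) × (ι → ℝ) where
  toFun p := (∑ i, ∑ j, c i j * p (i, j), fun i => ∑ j, p (i, j), fun j => ∑ i, p (i, j))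
  map_add' p q := by
    ext <;> simp [mul_add, Finset.sum_add_distrib]
  map_smul' r p := by
    ext <;> simp [Finset.mul_sum, mul_left_comm]

theorem costMarginals_single [DecidableEq ι] (c : ι → ι → ℝ) (i j : ι) :
    costMarginals c (Pi.single (i, j) 1) = (c i j, Pi.single i 1, Pi.single j 1) := by
  have h : ∀ k l, (Pi.single (i, j) (1 : ℝ) : ι × ι → ℝ) (k, l)
      = if k = i then (if l = j then 1 else 0) else 0 := by
    intro k l
    simp only [Pi.single_apply, Prod.mk.injEq]
    split_ifs <;> simp_all
  ext k
  · simp [costMarginals, h]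
  · simp [costMarginals, h, Pi.single_apply]
  · simp [costMarginals, h, Pi.single_apply]

/-- A strict lower bound for the cost of the plans between `a` and `b` is attained by a pair of
dual potentials. -/
theorem exists_potentials (c : ι → ι → ℝ) {a b : ι → ℝ}
    (ha : a ∈ stdSimplex ℝ ι) (hb : b ∈ stdSimplex ℝ ι) {v : ℝ}
    (hv : ∀ p, IsPlan a b p → v < ∑ i, ∑ j, c i j * p i j) :
    ∃ φ ψ : ι → ℝ, (∀ i j, φ i + ψ j ≤ c i j) ∧ v ≤ ∑ i, φ i * a i + ∑ j, ψ j * b j := by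
  classical
  have hK : IsCompact (costMarginals c '' stdSimplex ℝ (ι × ι)) :=
    (isCompact_stdSimplex ℝ (ι × ι)).image (LinearMap.continuous_of_finiteDimensional _)
  have hconv : Convex ℝ (costMarginals c '' stdSimplex ℝ (ι × ι)) :=
    (convex_stdSimplex ℝ (ι × ι)).linear_image _
  have hnot : (v, a, b) ∉ costMarginals c '' stdSimplex ℝ (ι × ι) := by
    rintro ⟨p, hp, hpe⟩
    simp only [costMarginals, LinearMap.coe_mk, AddHom.coe_mk, Prod.mk.injEq] at hpe
    obtain ⟨h1, h2, h3⟩ := hpe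
    exact (hv (fun i j => p (i, j))
      ⟨fun i j => hp.1 _, fun i => congrFun h2 i, fun j => congrFun h3 j⟩).ne' h1
  obtain ⟨f, u, hf, hu⟩ := geometric_hahn_banach_closed_point hconv hK.isClosed hnot
  -- The separating functional is determined by its value `l` on the cost axis and by its values
  -- `φ`, `ψ` on the marginal axes.
  set l : ℝ := f (1, 0, 0) with hl
  set φ : ι → ℝ := fun i => f (0, Pi.single i 1, 0) with hφ
  set ψ : ι → ℝ := fun j => f (0, 0, Pi.single j 1) with hψ
  have hsplit : ∀ t x y, f (t, x, y) = l * t + ∑ i, φ i * x i + ∑ j, ψ j * y j := by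
    intro t x y
    have e1 : ((t, x, y) : ℝ × (ι → ℝ) × (ι → ℝ)) = t • (1, 0, 0)
        + ∑ i, x i • ((0, Pi.single i 1, 0) : ℝ × (ι → ℝ) × (ι → ℝ))
        + ∑ j, y j • ((0, 0, Pi.single j 1) : ℝ × (ι → ℝ) × (ι → ℝ)) := by
      ext k
      · simp [Prod.fst_sum]
      · simp [Prod.fst_sum, Prod.snd_sum, Pi.single_apply]
      · simp [Prod.snd_sum, Pi.single_apply]
    rw [e1, map_add, map_add, map_sum, map_sum]
    simp only [map_smul, smul_eq_mul, hl, hφ, hψ, mul_comm]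
  have hv0 := hv _ (isPlan_mul ha hb)
  -- The product plan has the same marginals as the separated point but a cost above `v`, so only
  -- the cost axis can distinguish them.
  have hneg : l < 0 := by
    have h1 : costMarginals c (fun ij => a ij.1 * b ij.2)
        = (∑ i, ∑ j, c i j * (a i * b j), a, b) := by
      have := isPlan_mul ha hb
      simp only [costMarginals, LinearMap.coe_mk, AddHom.coe_mk, Prod.mk.injEq, true_and]
      exact ⟨funext this.row, funext this.col⟩
    have h2 := hf _ ⟨fun ij => a ij.1 * b ij.2, ⟨fun ij => mul_nonneg (ha.1 _) (hb.1 _), by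
      rw [Fintype.sum_prod_type]
      simp only [← Finset.mul_sum, hb.2, mul_one, ha.2]⟩, h1⟩
    have h3 := h2.trans hu
    rw [hsplit, hsplit] at h3
    nlinarith
  -- Evaluate the separation at the vertices of the simplex.
  have hcell : ∀ i j, l * c i j + φ i + ψ j < u := by
    intro i j
    have := hf _ ⟨_, single_mem_stdSimplex ℝ (i, j), costMarginals_single c i j⟩
    rw [hsplit] at this
    simpa [Pi.single_apply] using this
  have hl' : 0 < -l := neg_pos.2 hneg
  -- Normalize the cost coefficient to `-1`; the level `u` can be absorbed into `φ` because `a` has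
  -- total mass 1.
  refine ⟨fun i => (φ i - u) / (-l), fun j => ψ j / (-l), fun i j => ?_, ?_⟩
  · rw [← add_div, div_le_iff₀ hl']
    have := hcell i j
    linarith
  · have e1 : ∑ i, (φ i - u) / (-l) * a i + ∑ j, ψ j / (-l) * b j
        = (∑ i, φ i * a i + ∑ j, ψ j * b j - u) / (-l) := by
      have : ∑ i, (φ i - u) / (-l) * a i = (∑ i, φ i * a i - u) / (-l) := by
        calc ∑ i, (φ i - u) / (-l) * a i = ∑ i, (φ i * a i - u * a i) / (-l) :=
              Finset.sum_congr rfl fun i _ => by ring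
          _ = _ := by
              rw [← Finset.sum_div, Finset.sum_sub_distrib, ← Finset.mul_sum, ha.2, mul_one]
      rw [this, Finset.sum_congr rfl fun j _ => div_mul_eq_mul_div (ψ j) (-l) (b j),
        ← Finset.sum_div]
      ring
    rw [e1, le_div_iff₀ hl']
    rw [hsplit] at hu
    linarith

/-- Kantorovich–Rubinstein duality for weights on a finite family of points, up to `ε`. -/
theorem exists_plan_lipschitz [MetricSpace X] (e : ι → X) {a b : ι → ℝ}
    (ha : a ∈ stdSimplex ℝ ι) (hb : b ∈ stdSimplex ℝ ι) {ε : ℝ} (hε : 0 < ε) :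
    ∃ (p : ι → ι → ℝ) (g : X → ℝ), IsPlan a b p ∧ LipschitzWith 1 g ∧
      ∑ i, ∑ j, dist (e i) (e j) * p i j ≤ ∑ i, g (e i) * (b i - a i) + ε := by
  have hne : Nonempty ι := by
    by_contra h
    rw [not_nonempty_iff] at h
    simpa using ha.2
  let S : Set ℝ := {r | ∃ p, IsPlan a b p ∧ ∑ i, ∑ j, dist (e i) (e j) * p i j = r}
  have hS : S.Nonempty := ⟨_, _, isPlan_mul ha hb, rfl⟩
  have hbdd : BddBelow S := by
    refine ⟨0, ?_⟩
    rintro _ ⟨p, hp, rfl⟩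
    exact Finset.sum_nonneg fun i _ => Finset.sum_nonneg fun j _ =>
      mul_nonneg dist_nonneg (hp.nonneg i j)
  obtain ⟨_, ⟨p, hp, rfl⟩, hlt⟩ := exists_lt_of_csInf_lt hS
    (show sInf S < sInf S + ε / 2 by linarith)
  -- Lowering the infimum by `ε / 2` gives the strict bound required for separation; the other `ε /
  -- 2` was spent on `p`.
  obtain ⟨φ, ψ, hle, hval⟩ := exists_potentials (fun i j => dist (e i) (e j)) ha hb
    (v := sInf S - ε / 2) (fun q hq => by
      have := csInf_le hbdd (show _ ∈ S from ⟨q, hq, rfl⟩)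
      linarith)
  refine ⟨p, fun x => ⨅ i, (dist x (e i) - φ i), hp, lipschitzWith_iInf_dist_sub e φ, ?_⟩
  have h1 : ∀ i, ⨅ k, (dist (e i) (e k) - φ k) ≤ -φ i := by
    intro i
    have := ciInf_le (Set.finite_range (fun k => dist (e i) (e k) - φ k)).bddBelow i
    simpa using this
  have h2 : ∀ j, ψ j ≤ ⨅ k, (dist (e j) (e k) - φ k) := by
    refine fun j => le_ciInf fun k => ?_
    have := hle k j
    rw [dist_comm] at this
    linarith
  -- With `g` the transform of `φ`, `h1` and `h2` say `φ ≤ -g` and `ψ ≤ g` at the points, so `g`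
  -- does at least as well as the pair.
  have h3 : ∑ i, φ i * a i + ∑ j, ψ j * b j
      ≤ ∑ i, (⨅ k, (dist (e i) (e k) - φ k)) * (b i - a i) := by
    rw [← Finset.sum_add_distrib]
    refine Finset.sum_le_sum fun i _ => ?_
    have := mul_le_mul_of_nonneg_right (h1 i) (ha.1 i)
    have := mul_le_mul_of_nonneg_right (h2 i) (hb.1 i)
    linarith
  linarith

end FiniteDuality

/-! ### Adapting a plan to perturbed marginals -/

section Repair

variable {ι : Type*} [Fintype ι]

/-- The part of the plan `q` between `a'` and `b'` that is compatible with the weights `a`, `b`. -/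
noncomputable def shrinkPlan (q : ι → ι → ℝ) (a' b' a b : ι → ℝ) (i j : ι) : ℝ :=
  q i j * min 1 (a i / a' i) * min 1 (b j / b' j)

/-- The mass of `a` that is not transported by `shrinkPlan`. -/
noncomputable def rowDefect (q : ι → ι → ℝ) (a' b' a b : ι → ℝ) (i : ι) : ℝ :=
  a i - ∑ j, shrinkPlan q a' b' a b i j

/-- The mass of `b` that is not transported by `shrinkPlan`. -/
noncomputable def colDefect (q : ι → ι → ℝ) (a' b' a b : ι → ℝ) (j : ι) : ℝ :=
  b j - ∑ i, shrinkPlan q a' b' a b i j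

/-- The plan `q` between `a'` and `b'`, changed into a plan between `a` and `b`. -/
noncomputable def repairPlan (q : ι → ι → ℝ) (a' b' a b : ι → ℝ) (i j : ι) : ℝ :=
  shrinkPlan q a' b' a b i j + rowDefect q a' b' a b i * colDefect q a' b' a b j
    / ∑ k, rowDefect q a' b' a b k

theorem measurable_repairPlan (q : ι → ι → ℝ) (a' b' : ι → ℝ) (i j : ι) :
    Measurable fun s : (ι → ℝ) × (ι → ℝ) => repairPlan q a' b' s.1 s.2 i j := by
  unfold repairPlan rowDefect colDefect shrinkPlan
  fun_prop

variable {q : ι → ι → ℝ} {a' b' a b : ι → ℝ}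

theorem mul_min_one_div_le {x y : ℝ} (hx : 0 ≤ x) (hy : 0 ≤ y) : x * min 1 (y / x) ≤ y := by
  rcases hx.eq_or_lt with rfl | hx
  · simpa using hy
  · calc x * min 1 (y / x) ≤ x * (y / x) := by gcongr; exact min_le_right _ _
      _ = y := by field_simp

theorem mul_one_sub_min_le {x y : ℝ} (hx : 0 ≤ x) : x * (1 - min 1 (y / x)) ≤ |y - x| := by
  rcases hx.eq_or_lt with rfl | hx
  · simp
  · rcases le_total 1 (y / x) with h | h
    · simp [min_eq_left h]
    · rw [min_eq_right h, mul_sub, mul_one, mul_div_cancel₀ _ hx.ne', abs_sub_comm]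
      exact le_abs_self _

theorem shrinkPlan_nonneg (hq : IsPlan a' b' q) (ha : 0 ≤ a) (hb : 0 ≤ b) (i j : ι) :
    0 ≤ shrinkPlan q a' b' a b i j := by
  have ha' : 0 ≤ a' i := hq.row i ▸ Finset.sum_nonneg fun j _ => hq.nonneg i j
  have hb' : 0 ≤ b' j := hq.col j ▸ Finset.sum_nonneg fun i _ => hq.nonneg i j
  exact mul_nonneg (mul_nonneg (hq.nonneg i j) (le_min zero_le_one (div_nonneg (ha i) ha')))
    (le_min zero_le_one (div_nonneg (hb j) hb'))

theorem shrinkPlan_le (hq : IsPlan a' b' q) (ha : 0 ≤ a) (i j : ι) :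
    shrinkPlan q a' b' a b i j ≤ q i j := by
  have ha' : 0 ≤ a' i := hq.row i ▸ Finset.sum_nonneg fun j _ => hq.nonneg i j
  have h1 : 0 ≤ min 1 (a i / a' i) := le_min zero_le_one (div_nonneg (ha i) ha')
  have h2 : q i j * min 1 (a i / a' i) ≤ q i j :=
    mul_le_of_le_one_right (hq.nonneg i j) (min_le_left _ _)
  exact (mul_le_of_le_one_right (mul_nonneg (hq.nonneg i j) h1) (min_le_left _ _)).trans h2

theorem rowDefect_nonneg (hq : IsPlan a' b' q) (ha : 0 ≤ a) (i : ι) :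
    0 ≤ rowDefect q a' b' a b i := by
  have ha' : 0 ≤ a' i := hq.row i ▸ Finset.sum_nonneg fun j _ => hq.nonneg i j
  have h1 : 0 ≤ min 1 (a i / a' i) := le_min zero_le_one (div_nonneg (ha i) ha')
  refine sub_nonneg.2 ?_
  calc ∑ j, shrinkPlan q a' b' a b i j ≤ ∑ j, q i j * min 1 (a i / a' i) :=
        Finset.sum_le_sum fun j _ =>
          mul_le_of_le_one_right (mul_nonneg (hq.nonneg i j) h1) (min_le_left _ _)
    _ = a' i * min 1 (a i / a' i) := by rw [← Finset.sum_mul, hq.row]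
    _ ≤ a i := mul_min_one_div_le ha' (ha i)

theorem colDefect_nonneg (hq : IsPlan a' b' q) (hb : 0 ≤ b) (j : ι) :
    0 ≤ colDefect q a' b' a b j := by
  have hb' : 0 ≤ b' j := hq.col j ▸ Finset.sum_nonneg fun i _ => hq.nonneg i j
  have h1 : 0 ≤ min 1 (b j / b' j) := le_min zero_le_one (div_nonneg (hb j) hb')
  refine sub_nonneg.2 ?_
  calc ∑ i, shrinkPlan q a' b' a b i j ≤ ∑ i, q i j * min 1 (b j / b' j) :=
        Finset.sum_le_sum fun i _ => mul_le_mul_of_nonneg_right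
          (mul_le_of_le_one_right (hq.nonneg i j) (min_le_left _ _)) h1
    _ = b' j * min 1 (b j / b' j) := by rw [← Finset.sum_mul, hq.col]
    _ ≤ b j := mul_min_one_div_le hb' (hb j)

theorem sum_colDefect_eq (ha : a ∈ stdSimplex ℝ ι) (hb : b ∈ stdSimplex ℝ ι) :
    ∑ j, colDefect q a' b' a b j = ∑ i, rowDefect q a' b' a b i := by
  simp only [colDefect, rowDefect, Finset.sum_sub_distrib, ha.2, hb.2]
  rw [Finset.sum_comm]

/-- After shrinking, the missing row and column masses are nonnegative with the same total `m`, so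
their product divided by `m` supplies exactly what is missing. -/
theorem isPlan_repairPlan (hq : IsPlan a' b' q) (ha : a ∈ stdSimplex ℝ ι)
    (hb : b ∈ stdSimplex ℝ ι) : IsPlan a b (repairPlan q a' b' a b) := by
  have hr := rowDefect_nonneg (b := b) hq ha.1
  have hc := colDefect_nonneg (a := a) hq hb.1
  have hsum := sum_colDefect_eq (q := q) (a' := a') (b' := b') ha hb
  set m := ∑ k, rowDefect q a' b' a b k with hm
  -- If `m = 0` all defects vanish, so division by zero does no harm.
  have hcancel : ∀ x : ℝ, (m = 0 → x = 0) → x * m / m = x := by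
    intro x hx
    rcases eq_or_ne m 0 with h | h
    · simp [h, hx h]
    · field_simp
  refine ⟨fun i j => add_nonneg (shrinkPlan_nonneg hq ha.1 hb.1 i j)
    (div_nonneg (mul_nonneg (hr i) (hc j)) (Finset.sum_nonneg fun k _ => hr k)), fun i => ?_,
    fun j => ?_⟩
  · simp only [repairPlan, Finset.sum_add_distrib, ← Finset.sum_div, ← Finset.mul_sum, hsum, ← hm]
    rw [hcancel _ fun h => (Finset.sum_eq_zero_iff_of_nonneg fun k _ => hr k).1 h i
      (Finset.mem_univ i), rowDefect]
    ring
  · simp only [repairPlan, Finset.sum_add_distrib, ← Finset.sum_div, ← Finset.sum_mul, ← hm]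
    rw [mul_comm, hcancel _ fun h => (Finset.sum_eq_zero_iff_of_nonneg fun k _ => hc k).1
      (hsum.trans h) j (Finset.mem_univ j), colDefect]
    ring

theorem sum_rowDefect_le (hq : IsPlan a' b' q) (ha' : a' ∈ stdSimplex ℝ ι)
    (ha : a ∈ stdSimplex ℝ ι) :
    ∑ i, rowDefect q a' b' a b i ≤ ∑ i, |a i - a' i| + ∑ j, |b j - b' j| := by
  have ha0 : ∀ i, 0 ≤ a' i := ha'.1
  have hb0 : ∀ j, 0 ≤ b' j := fun j => hq.col j ▸ Finset.sum_nonneg fun i _ => hq.nonneg i j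
  have h1 : ∑ i, rowDefect q a' b' a b i = ∑ i, ∑ j, (q i j - shrinkPlan q a' b' a b i j) := by
    simp only [rowDefect, Finset.sum_sub_distrib, ha.2, hq.row, ha'.2]
  have h2 : ∀ i j, q i j - shrinkPlan q a' b' a b i j
      ≤ q i j * (1 - min 1 (a i / a' i)) + q i j * (1 - min 1 (b j / b' j)) := by
    intro i j
    have hr : min 1 (a i / a' i) ≤ 1 := min_le_left _ _
    have hs : min 1 (b j / b' j) ≤ 1 := min_le_left _ _
    -- `(1 - r)(1 - s) ≥ 0` gives `1 - r s ≤ (1 - r) + (1 - s)`.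
    have := mul_nonneg (hq.nonneg i j) (mul_nonneg (sub_nonneg.2 hr) (sub_nonneg.2 hs))
    unfold shrinkPlan
    linarith
  have h3 : ∑ i, ∑ j, q i j * (1 - min 1 (a i / a' i)) ≤ ∑ i, |a i - a' i| := by
    refine Finset.sum_le_sum fun i _ => ?_
    rw [← Finset.sum_mul, hq.row]
    exact mul_one_sub_min_le (ha0 i)
  have h4 : ∑ i, ∑ j, q i j * (1 - min 1 (b j / b' j)) ≤ ∑ j, |b j - b' j| := by
    rw [Finset.sum_comm]
    refine Finset.sum_le_sum fun j _ => ?_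
    rw [← Finset.sum_mul, hq.col]
    exact mul_one_sub_min_le (hb0 j)
  rw [h1]
  refine (Finset.sum_le_sum fun i _ => Finset.sum_le_sum fun j _ => h2 i j).trans ?_
  simp only [Finset.sum_add_distrib]
  linarith

/-- Shrinking does not raise the cost, and the added mass, at most the ℓ¹ change of the marginals,
costs at most `C` per unit. -/
theorem sum_mul_repairPlan_le (hq : IsPlan a' b' q) (ha' : a' ∈ stdSimplex ℝ ι)
    (ha : a ∈ stdSimplex ℝ ι) (hb : b ∈ stdSimplex ℝ ι) {c : ι → ι → ℝ} {C : ℝ}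
    (hc : ∀ i j, 0 ≤ c i j) (hcC : ∀ i j, c i j ≤ C) (hC : 0 ≤ C) :
    ∑ i, ∑ j, c i j * repairPlan q a' b' a b i j
      ≤ ∑ i, ∑ j, c i j * q i j + C * (∑ i, |a i - a' i| + ∑ j, |b j - b' j|) := by
  have hr := rowDefect_nonneg (b := b) hq ha.1
  have hcd := colDefect_nonneg (a := a) hq hb.1
  set m := ∑ k, rowDefect q a' b' a b k with hm
  have hm0 : 0 ≤ m := Finset.sum_nonneg fun k _ => hr k
  have h1 : ∀ i j, c i j * repairPlan q a' b' a b i j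
      ≤ c i j * q i j + C * (rowDefect q a' b' a b i * colDefect q a' b' a b j / m) := by
    intro i j
    rw [repairPlan, mul_add]
    exact add_le_add (mul_le_mul_of_nonneg_left (shrinkPlan_le hq ha.1 i j) (hc i j))
      (mul_le_mul_of_nonneg_right (hcC i j) (div_nonneg (mul_nonneg (hr i) (hcd j)) hm0))
  refine (Finset.sum_le_sum fun i _ => Finset.sum_le_sum fun j _ => h1 i j).trans ?_
  simp only [Finset.sum_add_distrib, ← Finset.mul_sum, ← Finset.sum_div, ← Finset.sum_mul,
    sum_colDefect_eq (q := q) (a' := a') (b' := b') ha hb, ← hm]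
  have h2 := sum_rowDefect_le (b := b) hq ha' ha
  rw [← hm] at h2
  have h3 : m * m / m = m := by
    rcases eq_or_ne m 0 with h | h
    · simp [h]
    · field_simp
  rw [h3]
  gcongr

end Repair

/-! ### Measurable choice of near-optimizers -/

section Selection

variable {ι X : Type*} [Fintype ι] [MetricSpace X] [MeasurableSpace X] [OpensMeasurableSpace X]

/-- Nearly optimal plans and nearly optimal potentials can be chosen measurably in the weights. -/
theorem exists_measurable_plan_lipschitz (e : ι → X) {ε : ℝ} (hε : 0 < ε) :
    ∃ (p : stdSimplex ℝ ι × stdSimplex ℝ ι → ι → ι → ℝ)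
      (g : stdSimplex ℝ ι × stdSimplex ℝ ι → X → ℝ),
      (∀ i j, Measurable fun s => p s i j) ∧ Measurable (Function.uncurry g) ∧
      ∀ s, IsPlan s.1 s.2 (p s) ∧ LipschitzWith 1 (g s) ∧
        ∑ i, ∑ j, dist (e i) (e j) * p s i j ≤ ∑ i, g s (e i) * (s.2.1 i - s.1.1 i) + ε := by
  classical
  rcases isEmpty_or_nonempty (stdSimplex ℝ ι × stdSimplex ℝ ι) with hS | hS
  · exact ⟨fun _ _ _ => 0, fun _ _ => 0, fun _ _ => measurable_const, measurable_const,
      fun s => (hS.false s).elim⟩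
  have hι : Nonempty ι := by
    obtain ⟨s, -⟩ := hS
    by_contra h
    rw [not_nonempty_iff] at h
    simpa using s.2.2
  obtain ⟨C, hC0, hC⟩ : ∃ C : ℝ, 0 ≤ C ∧ ∀ i j, dist (e i) (e j) ≤ C := by
    obtain ⟨C, hC⟩ := (Set.finite_range fun ij : ι × ι => dist (e ij.1) (e ij.2)).bddAbove
    exact ⟨max C 0, le_max_right _ _, fun i j => (hC ⟨(i, j), rfl⟩).trans (le_max_left _ _)⟩
  set N : ℝ := (Fintype.card ι : ℝ) with hN
  have hN0 : 0 ≤ N := Nat.cast_nonneg _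
  -- Moving both weights by `δ` per coordinate changes the plan's cost and the dual value by at most
  -- `2 * C * N * δ` each; the `+ 1` keeps the denominator positive.
  obtain ⟨δ, hδ, hδε⟩ : ∃ δ : ℝ, 0 < δ ∧ 4 * C * N * δ ≤ ε / 2 := by
    refine ⟨ε / (8 * (C * N + 1)), by positivity, ?_⟩
    rw [← mul_div_assoc, div_le_div_iff₀ (by positivity) two_pos]
    nlinarith
  set σ := TopologicalSpace.denseSeq (stdSimplex ℝ ι × stdSimplex ℝ ι)
  have hfind : ∀ s, ∃ k, dist s (σ k) < δ := fun s =>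
    (TopologicalSpace.denseRange_denseSeq _).exists_dist_lt s hδ
  -- The least index is measurable and takes countably many values, so measurability need only be
  -- checked for each fixed index.
  set κ : stdSimplex ℝ ι × stdSimplex ℝ ι → ℕ := fun s => Nat.find (hfind s)
  have hκ : Measurable κ := measurable_find hfind fun k =>
    (isOpen_lt (continuous_id.dist continuous_const) continuous_const).measurableSet
  choose q g hq hg hqg using fun k => exists_plan_lipschitz e (σ k).1.2 (σ k).2.2 (half_pos hε)
  refine ⟨fun s => repairPlan (q (κ s)) (σ (κ s)).1 (σ (κ s)).2 s.1 s.2, fun s => g (κ s),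
    fun i j => ?_, ?_, fun s => ⟨isPlan_repairPlan (hq _) s.1.2 s.2.2, hg _, ?_⟩⟩
  · have h : Measurable fun z : ℕ × (stdSimplex ℝ ι × stdSimplex ℝ ι) =>
        repairPlan (q z.1) (σ z.1).1 (σ z.1).2 z.2.1 z.2.2 i j :=
      measurable_from_prod_countable_right fun k =>
        (measurable_repairPlan (q k) (σ k).1 (σ k).2 i j).comp
          ((measurable_subtype_coe.comp measurable_fst).prodMk
            (measurable_subtype_coe.comp measurable_snd))
    exact h.comp (hκ.prodMk measurable_id)
  · have h : Measurable fun z : ℕ × X => g z.1 z.2 :=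
      measurable_from_prod_countable_right fun k => (hg k).continuous.measurable
    exact h.comp ((hκ.comp measurable_fst).prodMk measurable_snd)
  · set t := σ (κ s)
    have hst : dist s t < δ := Nat.find_spec (hfind s)
    have hd1 : ∀ i, |s.1.1 i - t.1.1 i| ≤ δ := fun i => by
      rw [← Real.dist_eq]
      exact (dist_le_pi_dist s.1.1 t.1.1 i).trans ((le_max_left _ _).trans hst.le)
    have hd2 : ∀ i, |s.2.1 i - t.2.1 i| ≤ δ := fun i => by
      rw [← Real.dist_eq]
      exact (dist_le_pi_dist s.2.1 t.2.1 i).trans ((le_max_right _ _).trans hst.le)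
    have hs1 : ∑ i, |s.1.1 i - t.1.1 i| ≤ N * δ := by
      simpa [hN] using Finset.sum_le_sum fun i (_ : i ∈ Finset.univ) => hd1 i
    have hs2 : ∑ i, |s.2.1 i - t.2.1 i| ≤ N * δ := by
      simpa [hN] using Finset.sum_le_sum fun i (_ : i ∈ Finset.univ) => hd2 i
    have hcost := sum_mul_repairPlan_le (hq (κ s)) t.1.2 s.1.2 s.2.2
      (c := fun i j => dist (e i) (e j)) (fun i j => dist_nonneg) hC hC0
    have hpot : ∀ {u v : ι → ℝ}, u ∈ stdSimplex ℝ ι → v ∈ stdSimplex ℝ ι →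
        (∑ i, |u i - v i| ≤ N * δ) →
        |∑ i, g (κ s) (e i) * (u i - v i)| ≤ C * (N * δ) := by
      intro u v hu hv huv
      -- Equal total masses allow subtracting a constant from `g`, after which its values are
      -- bounded by the diameter bound `C`.
      have e1 : ∑ i, g (κ s) (e i) * (u i - v i)
          = ∑ i, (g (κ s) (e i) - g (κ s) (e hι.some)) * (u i - v i) := by
        simp only [sub_mul (g _ _), Finset.sum_sub_distrib, ← Finset.mul_sum, hu.2, hv.2, sub_self,
          mul_zero, sub_zero]
      rw [e1]
      refine (Finset.abs_sum_le_sum_abs _ _).trans ?_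
      refine le_trans (Finset.sum_le_sum fun i _ => ?_)
        ((Finset.mul_sum _ _ _).symm.le.trans (mul_le_mul_of_nonneg_left huv hC0))
      rw [abs_mul]
      refine mul_le_mul_of_nonneg_right ?_ (abs_nonneg _)
      have := (hg (κ s)).dist_le_mul (e i) (e hι.some)
      rw [Real.dist_eq, NNReal.coe_one, one_mul] at this
      exact this.trans (hC _ _)
    have hp1 := (abs_le.1 (hpot s.1.2 t.1.2 hs1)).2
    have hp2 := (abs_le.1 (hpot s.2.2 t.2.2 hs2)).1
    have hsplit : ∑ i, g (κ s) (e i) * (s.2.1 i - s.1.1 i)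
        = ∑ i, g (κ s) (e i) * (t.2.1 i - t.1.1 i)
          + ∑ i, g (κ s) (e i) * (s.2.1 i - t.2.1 i)
          - ∑ i, g (κ s) (e i) * (s.1.1 i - t.1.1 i) := by
      rw [← Finset.sum_add_distrib, ← Finset.sum_sub_distrib]
      exact Finset.sum_congr rfl fun i _ => by ring
    have hopt := hqg (κ s)
    have hCd : C * (∑ i, |s.1.1 i - t.1.1 i| + ∑ j, |s.2.1 j - t.2.1 j|) ≤ C * (N * δ + N * δ) :=
      mul_le_mul_of_nonneg_left (add_le_add hs1 hs2) hC0
    refine hcost.trans ?_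
    rw [hsplit]
    change _ ≤ ∑ i, g (κ s) (e i) * ((σ (κ s)).2.1 i - (σ (κ s)).1.1 i) + _ - _ + _
    linarith

end Selection

/-! ### Lifting finite plans to couplings of kernels -/

section Lift

variable {Ω X Y ι : Type*} [MeasurableSpace Ω] [MeasurableSpace X] [MeasurableSpace Y]

/-- The weights of the fibres of a map to a finite set. -/
noncomputable def fiberWeights (T : X → ι) (μ : Measure X) (i : ι) : ℝ := μ.real (T ⁻¹' {i})

/-- The density, on the product of the fibres over `i` and `j`, of the plan which has mass `p i j`
there and is a multiple of the product measure. -/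
noncomputable def planDensity (T : X → ι) (S : Y → ι) (μ : Measure X) (ν : Measure Y)
    (p : ι → ι → ℝ) (i j : ι) : ℝ≥0∞ :=
  ENNReal.ofReal (p i j) / (μ (T ⁻¹' {i}) * ν (S ⁻¹' {j}))

variable {T : X → ι} {S : Y → ι} {p : ι → ι → ℝ}

theorem planDensity_swap (μ : Measure X) (ν : Measure Y) (i j : ι) :
    planDensity T S μ ν p i j = planDensity S T ν μ (fun i j => p j i) j i := by
  rw [planDensity, planDensity, mul_comm]

variable [Fintype ι]

/-- A null fibre has zero weight, which forces `p i j = 0`; the quotient is therefore harmless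
there. -/
theorem planDensity_mul (μ : Measure X) (ν : Measure Y) [IsProbabilityMeasure μ]
    [IsProbabilityMeasure ν] (hp : IsPlan (fiberWeights T μ) (fiberWeights S ν) p) (i j : ι) :
    planDensity T S μ ν p i j * (μ (T ⁻¹' {i}) * ν (S ⁻¹' {j})) = ENNReal.ofReal (p i j) := by
  refine ENNReal.div_mul_cancel' (fun h => ?_)
    fun h => (ENNReal.mul_ne_top (measure_ne_top _ _) (measure_ne_top _ _) h).elim
  rw [ENNReal.ofReal_eq_zero]
  rcases mul_eq_zero.1 h with h | h
  · calc p i j ≤ ∑ j, p i j :=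
          Finset.single_le_sum (fun j _ => hp.nonneg i j) (Finset.mem_univ j)
      _ = 0 := by rw [hp.row, fiberWeights, measureReal_def, h, ENNReal.toReal_zero]
  · calc p i j ≤ ∑ i, p i j :=
          Finset.single_le_sum (f := fun i => p i j) (fun i _ => hp.nonneg i j) (Finset.mem_univ i)
      _ = 0 := by rw [hp.col, fiberWeights, measureReal_def, h, ENNReal.toReal_zero]

theorem sum_planDensity_mul (μ : Measure X) (ν : Measure Y) [IsProbabilityMeasure μ]
    [IsProbabilityMeasure ν] (hp : IsPlan (fiberWeights T μ) (fiberWeights S ν) p) {i : ι}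
    (hi : μ (T ⁻¹' {i}) ≠ 0) : ∑ j, planDensity T S μ ν p i j * ν (S ⁻¹' {j}) = 1 := by
  have h : μ (T ⁻¹' {i}) * ∑ j, planDensity T S μ ν p i j * ν (S ⁻¹' {j})
      = μ (T ⁻¹' {i}) * 1 := by
    rw [Finset.mul_sum, mul_one]
    calc ∑ j, μ (T ⁻¹' {i}) * (planDensity T S μ ν p i j * ν (S ⁻¹' {j}))
        = ∑ j, ENNReal.ofReal (p i j) := Finset.sum_congr rfl fun j _ => by
          rw [← planDensity_mul μ ν hp i j]; ring
      _ = μ (T ⁻¹' {i}) := by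
          rw [← ENNReal.ofReal_sum_of_nonneg fun j _ => hp.nonneg i j, hp.row, fiberWeights,
            ofReal_measureReal]
  exact (ENNReal.mul_right_inj hi (measure_ne_top _ _)).1 h

theorem IsPlan.swap {a b : ι → ℝ} (hp : IsPlan a b p) : IsPlan b a fun i j => p j i :=
  ⟨fun i j => hp.nonneg j i, hp.col, hp.row⟩

variable [MeasurableSpace ι] [MeasurableSingletonClass ι]

theorem lintegral_comp_fintype (μ : Measure X) (hT : Measurable T) (h : ι → ℝ≥0∞) :
    ∫⁻ x, h (T x) ∂μ = ∑ i, h i * μ (T ⁻¹' {i}) := by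
  rw [← lintegral_map (measurable_of_finite h) hT, lintegral_fintype]
  exact Finset.sum_congr rfl fun i _ => by rw [Measure.map_apply hT (measurableSet_singleton i)]

theorem ae_measure_fiber_ne_zero (μ : Measure X) (hT : Measurable T) :
    ∀ᵐ x ∂μ, μ (T ⁻¹' {T x}) ≠ 0 := by
  refine ae_of_ae_map (p := fun i => μ (T ⁻¹' {i}) ≠ 0) hT.aemeasurable ?_
  rw [ae_iff_of_countable]
  intro i hi
  rwa [Measure.map_apply hT (measurableSet_singleton i)] at hi

theorem fiberWeights_mem_stdSimplex (hT : Measurable T) (μ : Measure X)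
    [IsProbabilityMeasure μ] : fiberWeights T μ ∈ stdSimplex ℝ ι := by
  refine ⟨fun i => measureReal_nonneg, ?_⟩
  have h := lintegral_comp_fintype μ hT fun _ => 1
  simp only [lintegral_const, measure_univ, one_mul] at h
  simp only [fiberWeights, measureReal_def]
  rw [← ENNReal.toReal_sum fun i _ => measure_ne_top _ _, ← h, ENNReal.toReal_one]

/-- Almost every `x` lies in a fibre of positive mass, where the row condition makes the inner
integral 1. This is the first-marginal property. -/
theorem setLIntegral_planDensity (hT : Measurable T) (hS : Measurable S) (μ : Measure X)
    (ν : Measure Y) [IsProbabilityMeasure μ] [IsProbabilityMeasure ν]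
    (hp : IsPlan (fiberWeights T μ) (fiberWeights S ν) p) (A : Set X) :
    ∫⁻ x in A, ∫⁻ y, planDensity T S μ ν p (T x) (S y) ∂ν ∂μ = μ A := by
  rw [← setLIntegral_one]
  refine lintegral_congr_ae (ae_restrict_of_ae ?_)
  filter_upwards [ae_measure_fiber_ne_zero μ hT] with x hx
  rw [lintegral_comp_fintype ν hS, sum_planDensity_mul μ ν hp hx]

/-- Kernel version of the gluing of a plan between fibre weights: there is a coupling whose image on
the finite set is the given plan. -/
theorem exists_mem_couplings_lift (hT : Measurable T) (hS : Measurable S) (μ : Kernel Ω X)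
    (ν : Kernel Ω Y) [IsMarkovKernel μ] [IsMarkovKernel ν] (p : Ω → ι → ι → ℝ)
    (hpm : ∀ i j, Measurable fun ω => p ω i j)
    (hp : ∀ ω, IsPlan (fiberWeights T (μ ω)) (fiberWeights S (ν ω)) (p ω)) :
    ∃ π ∈ couplings μ ν, ∀ (c : ι → ι → ℝ≥0∞) (ω : Ω),
      ∫⁻ z, c (T z.1) (S z.2) ∂(π ω) = ∑ i, ∑ j, c i j * ENNReal.ofReal (p ω i j) := by
  set w : Ω → X × Y → ℝ≥0∞ := fun ω z => planDensity T S (μ ω) (ν ω) (p ω) (T z.1) (S z.2)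
  have hTS : Measurable fun z : X × Y => (T z.1, S z.2) := by fun_prop
  have hwm : Measurable (Function.uncurry w) := by
    have h : Measurable fun z : (ι × ι) × Ω =>
        planDensity T S (μ z.2) (ν z.2) (p z.2) z.1.1 z.1.2 := by
      refine measurable_from_prod_countable_right fun ij => ?_
      have h1 := μ.measurable_coe (hT (measurableSet_singleton ij.1))
      have h2 := ν.measurable_coe (hS (measurableSet_singleton ij.2))
      have h3 := hpm ij.1 ij.2
      exact h3.ennreal_ofReal.div (Measurable.mul (f := fun ω => μ ω (T ⁻¹' {ij.1}))
        (g := fun ω => ν ω (S ⁻¹' {ij.2})) h1 h2)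
    exact h.comp ((hTS.comp measurable_snd).prodMk measurable_fst)
  have hw : ∀ ω, Measurable (w ω) := fun ω => hwm.comp measurable_prodMk_left
  set π : Kernel Ω (X × Y) := (μ ×ₖ ν).withDensity w with hπ
  have hπω : ∀ ω, π ω = ((μ ω).prod (ν ω)).withDensity (w ω) := fun ω => by
    rw [hπ, Kernel.withDensity_apply _ hwm, Kernel.prod_apply]
  have hfst : π.fst = μ := by
    ext ω A hA
    rw [Kernel.fst_apply, Measure.map_apply measurable_fst hA, hπω,
      withDensity_apply _ (measurable_fst hA)]
    have : Prod.fst ⁻¹' A = A ×ˢ (Set.univ : Set Y) := by ext; simp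
    rw [this, setLIntegral_prod _ (hw ω).aemeasurable, Measure.restrict_univ]
    exact setLIntegral_planDensity hT hS _ _ (hp ω) A
  have hsnd : π.snd = ν := by
    ext ω A hA
    rw [Kernel.snd_apply, Measure.map_apply measurable_snd hA, hπω,
      withDensity_apply _ (measurable_snd hA)]
    have : Prod.snd ⁻¹' A = (Set.univ : Set X) ×ˢ A := by ext; simp
    rw [this, setLIntegral_prod_symm _ (hw ω).aemeasurable, Measure.restrict_univ]
    simp only [w, planDensity_swap (T := T) (S := S)]
    exact setLIntegral_planDensity hS hT _ _ (hp ω).swap A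
  refine ⟨π, ⟨⟨fun ω => ⟨?_⟩⟩, hfst, hsnd⟩, fun c ω => ?_⟩
  · rw [← Set.preimage_univ (f := Prod.fst), ← Measure.map_apply measurable_fst MeasurableSet.univ,
      ← Kernel.fst_apply, hfst, measure_univ]
  · have hc : Measurable fun z : X × Y => c (T z.1) (S z.2) :=
      (measurable_of_finite fun ij : ι × ι => c ij.1 ij.2).comp hTS
    rw [hπω, lintegral_withDensity_eq_lintegral_mul _ (hw ω) hc,
      lintegral_prod _ ((hw ω).mul hc).aemeasurable]
    simp only [Pi.mul_apply, w]
    have h1 : ∀ x, ∫⁻ y, planDensity T S (μ ω) (ν ω) (p ω) (T x) (S y) * c (T x) (S y) ∂(ν ω)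
        = ∑ j, planDensity T S (μ ω) (ν ω) (p ω) (T x) j * c (T x) j * ν ω (S ⁻¹' {j}) :=
      fun x => lintegral_comp_fintype (ν ω) hS
        fun j => planDensity T S (μ ω) (ν ω) (p ω) (T x) j * c (T x) j
    simp only [h1]
    rw [lintegral_comp_fintype (μ ω) hT fun i =>
      ∑ j, planDensity T S (μ ω) (ν ω) (p ω) i j * c i j * ν ω (S ⁻¹' {j})]
    refine Finset.sum_congr rfl fun i _ => ?_
    rw [Finset.sum_mul]
    refine Finset.sum_congr rfl fun j _ => ?_
    rw [← planDensity_mul (μ ω) (ν ω) (hp ω)]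
    ring

end Lift

/-! ### Lipschitz and coupling estimates -/

section Estimates

variable {Ω X : Type*}

theorem enorm_sub_le_edist [MetricSpace X] {f : X → ℝ} (hf : LipschitzWith 1 f) (x y : X) :
    ‖f x - f y‖ₑ ≤ edist x y := by
  rw [← edist_eq_enorm_sub]
  simpa using hf x y

variable [MeasurableSpace Ω] [MeasurableSpace X]

theorem integrable_comp_simpleFunc (f : X → ℝ) (T : SimpleFunc X X) (m : Measure X)
    [IsFiniteMeasure m] : Integrable (fun x => f (T x)) m :=
  (T.map f).integrable_of_isFiniteMeasure

theorem integral_comp_fintype {ι : Type*} [Fintype ι] [MeasurableSpace ι]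
    [MeasurableSingletonClass ι] (m : Measure X) [IsFiniteMeasure m] {T : X → ι}
    (hT : Measurable T) (h : ι → ℝ) : ∫ x, h (T x) ∂m = ∑ i, h i * fiberWeights T m i := by
  rw [← integral_map hT.aemeasurable (measurable_of_finite h).aestronglyMeasurable,
    integral_fintype .of_finite]
  refine Finset.sum_congr rfl fun i _ => ?_
  rw [fiberWeights, map_measureReal_apply hT (measurableSet_singleton i), smul_eq_mul, mul_comm]

theorem lintegral_fst_of_mem_couplings {μ ν : Kernel Ω X} {π : Kernel Ω (X × X)}
    (hπ : π ∈ couplings μ ν) (ω : Ω) {f : X → ℝ≥0∞} (hf : Measurable f) :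
    ∫⁻ z, f z.1 ∂(π ω) = ∫⁻ x, f x ∂(μ ω) := by
  rw [← hπ.2.1, Kernel.lintegral_fst _ _ hf]

theorem lintegral_snd_of_mem_couplings {μ ν : Kernel Ω X} {π : Kernel Ω (X × X)}
    (hπ : π ∈ couplings μ ν) (ω : Ω) {f : X → ℝ≥0∞} (hf : Measurable f) :
    ∫⁻ z, f z.2 ∂(π ω) = ∫⁻ x, f x ∂(ν ω) := by
  rw [← hπ.2.2, Kernel.lintegral_snd _ _ hf]

theorem prod_mem_couplings (μ ν : Kernel Ω X) [IsMarkovKernel μ] [IsMarkovKernel ν] :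
    μ ×ₖ ν ∈ couplings μ ν :=
  ⟨inferInstance, Kernel.fst_prod _ _, Kernel.snd_prod _ _⟩

variable [MetricSpace X]

/-- Changing the base point adds a finite constant, so two kernels can share one base point. -/
theorem lintegral_edist_ne_top_of_mem_kernelSpace {P : Measure Ω} [IsFiniteMeasure P] {κ : Kernel Ω X}
    (hκ : κ ∈ kernelSpace 1 P) (x₀ : X) : ∫⁻ ω, ∫⁻ x, edist x x₀ ∂(κ ω) ∂P ≠ ∞ := by
  obtain ⟨_, x₁, h⟩ := hκ
  simp only [ENNReal.rpow_one] at h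
  have hle : ∫⁻ ω, ∫⁻ x, edist x x₀ ∂(κ ω) ∂P
      ≤ ∫⁻ ω, (∫⁻ x, edist x x₁ ∂(κ ω) + edist x₁ x₀) ∂P := by
    refine lintegral_mono fun ω => (lintegral_mono fun x => edist_triangle x x₁ x₀).trans ?_
    rw [lintegral_add_right _ measurable_const]
    simp
  refine (hle.trans_lt ?_).ne
  rw [lintegral_add_right _ measurable_const, lintegral_const]
  exact ENNReal.add_lt_top.2 ⟨h, ENNReal.mul_lt_top (edist_lt_top _ _) (measure_lt_top _ _)⟩

theorem wasserstein_one (P : Measure Ω) (μ ν : Kernel Ω X) : wasserstein 1 P μ ν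
    = ⨅ π ∈ couplings μ ν, ∫⁻ ω, ∫⁻ z, edist z.1 z.2 ∂(π ω) ∂P := by
  simp [wasserstein]

theorem abs_integral_sub_integral_comp_le {f : X → ℝ} (hf : LipschitzWith 1 f) {m : Measure X}
    [IsFiniteMeasure m] (hfi : Integrable f m) (T : SimpleFunc X X)
    (h : ∫⁻ x, edist x (T x) ∂m ≠ ∞) :
    |∫ x, f x ∂m - ∫ x, f (T x) ∂m| ≤ (∫⁻ x, edist x (T x) ∂m).toReal := by
  rw [← integral_sub hfi (integrable_comp_simpleFunc f T m), ← Real.norm_eq_abs, ← toReal_enorm]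
  exact ENNReal.toReal_mono h ((enorm_integral_le_lintegral_enorm _).trans
    (lintegral_mono fun x => enorm_sub_le_edist hf _ _))

variable [BorelSpace X]

theorem integrable_of_lipschitzWith {f : X → ℝ} (hf : LipschitzWith 1 f) (m : Measure X)
    [IsFiniteMeasure m] {x₀ : X} (h : ∫⁻ x, edist x x₀ ∂m ≠ ∞) : Integrable f m := by
  have h1 : Integrable (fun x => f x - f x₀) m := by
    refine ⟨(hf.continuous.measurable.sub_const _).aestronglyMeasurable, ?_⟩
    exact (lintegral_mono fun x => enorm_sub_le_edist hf x x₀).trans_lt h.lt_top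
  exact (h1.add (integrable_const (f x₀))).congr (ae_of_all _ fun x => sub_add_cancel _ _)

/-- Kantorovich–Rubinstein duality for kernels after quantization of the space by `T`. -/
theorem exists_coupling_lipOne_simpleFunc (μ ν : Kernel Ω X) [IsMarkovKernel μ] [IsMarkovKernel ν]
    (T : SimpleFunc X X) {ε : ℝ} (hε : 0 < ε) :
    ∃ π ∈ couplings μ ν, ∃ ψ ∈ lipOne Ω X, ∀ ω,
      0 ≤ ∫ x, ψ ω (T x) ∂(ν ω) - ∫ x, ψ ω (T x) ∂(μ ω) + ε ∧
      ∫⁻ z, edist (T z.1) (T z.2) ∂(π ω)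
        ≤ ENNReal.ofReal (∫ x, ψ ω (T x) ∂(ν ω) - ∫ x, ψ ω (T x) ∂(μ ω) + ε) := by
  let e : T.range → X := Subtype.val
  let T' : X → T.range := fun x => ⟨T x, T.mem_range_self x⟩
  have hT' : Measurable T' := T.measurable.subtype_mk
  obtain ⟨p, g, hpm, hgm, hpg⟩ := exists_measurable_plan_lipschitz e hε
  let s : Ω → stdSimplex ℝ T.range × stdSimplex ℝ T.range := fun ω =>
    (⟨_, fiberWeights_mem_stdSimplex hT' (μ ω)⟩, ⟨_, fiberWeights_mem_stdSimplex hT' (ν ω)⟩)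
  have hw : ∀ κ : Kernel Ω X, Measurable fun ω => fiberWeights T' (κ ω) := fun κ =>
    measurable_pi_lambda _ fun i =>
      (κ.measurable_coe (hT' (measurableSet_singleton i))).ennreal_toReal
  have hs : Measurable s := (hw μ).subtype_mk.prodMk (hw ν).subtype_mk
  obtain ⟨π, hπ, hcost⟩ := exists_mem_couplings_lift hT' hT' μ ν (fun ω => p (s ω))
    (fun i j => (hpm i j).comp hs) fun ω => (hpg (s ω)).1
  refine ⟨π, hπ, fun ω => g (s ω), ⟨?_, fun ω => (hpg (s ω)).2.1⟩, fun ω => ?_⟩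
  · exact hgm.comp ((hs.comp measurable_fst).prodMk measurable_snd)
  · obtain ⟨hp, -, hle⟩ := hpg (s ω)
    have hint : ∫ x, g (s ω) (T x) ∂(ν ω) - ∫ x, g (s ω) (T x) ∂(μ ω)
        = ∑ i, g (s ω) (e i) * ((s ω).2.1 i - (s ω).1.1 i) := by
      have h := fun κ : Measure X => fun [IsFiniteMeasure κ] =>
        integral_comp_fintype κ hT' fun i => g (s ω) (e i)
      simp only [mul_sub, Finset.sum_sub_distrib]
      exact congrArg₂ _ (h (ν ω)) (h (μ ω))
    rw [hint]
    have hnn : ∀ i j, 0 ≤ dist (e i) (e j) * p (s ω) i j := fun i j =>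
      mul_nonneg dist_nonneg (hp.nonneg i j)
    refine ⟨le_trans (Finset.sum_nonneg fun i _ => Finset.sum_nonneg fun j _ => hnn i j) hle, ?_⟩
    refine le_trans (le_of_eq ?_) (ENNReal.ofReal_le_ofReal hle)
    rw [ENNReal.ofReal_sum_of_nonneg fun i _ => Finset.sum_nonneg fun j _ => hnn i j]
    refine (hcost (fun i j => edist (e i) (e j)) ω).trans (Finset.sum_congr rfl fun i _ => ?_)
    rw [ENNReal.ofReal_sum_of_nonneg fun j _ => hnn i j]
    exact Finset.sum_congr rfl fun j _ => by
      rw [ENNReal.ofReal_mul dist_nonneg, edist_dist]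

theorem lintegral_edist_le_of_mem_couplings [SecondCountableTopology X] {μ ν : Kernel Ω X}
    {π : Kernel Ω (X × X)} (hπ : π ∈ couplings μ ν) (T : SimpleFunc X X) (ω : Ω) :
    ∫⁻ z, edist z.1 z.2 ∂(π ω) ≤ ∫⁻ x, edist x (T x) ∂(μ ω) + ∫⁻ x, edist x (T x) ∂(ν ω)
      + ∫⁻ z, edist (T z.1) (T z.2) ∂(π ω) := by
  have hm : Measurable fun x => edist x (T x) := measurable_id.edist T.measurable
  have h1 : Measurable fun z : X × X => edist z.1 (T z.1) := hm.comp measurable_fst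
  have h2 : Measurable fun z : X × X => edist z.2 (T z.2) := hm.comp measurable_snd
  rw [← lintegral_fst_of_mem_couplings hπ ω hm, ← lintegral_snd_of_mem_couplings hπ ω hm,
    ← lintegral_add_left h1, ← lintegral_add_left (by fun_prop)]
  refine lintegral_mono fun z => ?_
  calc edist z.1 z.2 ≤ edist z.1 (T z.1) + edist (T z.1) (T z.2) + edist (T z.2) z.2 :=
        edist_triangle4 _ _ _ _
    _ = _ := by rw [edist_comm (T z.2) z.2]; ring

theorem enorm_integral_sub_le_of_mem_couplings {μ ν : Kernel Ω X} {π : Kernel Ω (X × X)}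
    (hπ : π ∈ couplings μ ν) (ω : Ω) {f : X → ℝ} (hf : LipschitzWith 1 f)
    (hμ : Integrable f (μ ω)) (hν : Integrable f (ν ω)) :
    ‖∫ x, f x ∂(ν ω) - ∫ x, f x ∂(μ ω)‖ₑ ≤ ∫⁻ z, edist z.1 z.2 ∂(π ω) := by
  have hfm := hf.continuous.measurable
  have e1 : μ ω = (π ω).map Prod.fst := by rw [← hπ.2.1, Kernel.fst_apply]
  have e2 : ν ω = (π ω).map Prod.snd := by rw [← hπ.2.2, Kernel.snd_apply]
  rw [e1] at hμ ⊢
  rw [e2] at hν ⊢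
  rw [integral_map measurable_fst.aemeasurable hfm.aestronglyMeasurable,
    integral_map measurable_snd.aemeasurable hfm.aestronglyMeasurable,
    ← integral_sub (f := fun z : X × X => f z.2) (g := fun z : X × X => f z.1)
      (hν.comp_measurable measurable_snd) (hμ.comp_measurable measurable_fst)]
  refine (enorm_integral_le_lintegral_enorm _).trans (lintegral_mono fun z => ?_)
  rw [edist_comm]
  exact enorm_sub_le_edist hf _ _

end Estimates

/-! ### Quantization in mean and the two inequalities -/

section Main

variable {Ω X : Type*} [MeasurableSpace Ω] [MetricSpace X] [MeasurableSpace X] [BorelSpace X]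
  [SecondCountableTopology X] {P : Measure Ω}

theorem measurable_lintegral_edist (κ : Kernel Ω X) [IsSFiniteKernel κ] (T : SimpleFunc X X) :
    Measurable fun ω => ∫⁻ x, edist x (T x) ∂(κ ω) :=
  (Measurable.edist measurable_id T.measurable).lintegral_kernel

/-- Dominated convergence under the mixture `P.bind κ`: the approximation is never farther from `x`
than `x₀` is. -/
theorem tendsto_lintegral_edist_approxOn (κ : Kernel Ω X) {x₀ : X}
    (h : ∫⁻ ω, ∫⁻ x, edist x x₀ ∂(κ ω) ∂P ≠ ∞) :
    Filter.Tendsto (fun n => ∫⁻ ω, ∫⁻ x, edist x (SimpleFunc.approxOn id measurable_id Set.univ x₀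
      (Set.mem_univ _) n x) ∂(κ ω) ∂P) Filter.atTop (nhds 0) := by
  have hb : ∀ f : X → ℝ≥0∞, Measurable f →
      ∫⁻ ω, ∫⁻ x, f x ∂(κ ω) ∂P = ∫⁻ x, f x ∂(P.bind κ) := fun f hf =>
    (Measure.lintegral_bind κ.measurable.aemeasurable hf.aemeasurable).symm
  have hm : ∀ T : SimpleFunc X X, Measurable fun x => edist x (T x) := fun T =>
    measurable_id.edist T.measurable
  have hm₀ : Measurable fun x => edist x x₀ := measurable_id.edist measurable_const
  rw [hb _ hm₀] at h
  simp only [hb _ (hm _)]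
  rw [← lintegral_zero (μ := P.bind κ)]
  refine tendsto_lintegral_of_dominated_convergence _ (fun n => hm _)
    (fun n => ae_of_all _ fun x => ?_) h (ae_of_all _ fun x => ?_)
  · beta_reduce
    rw [edist_comm x, edist_comm x]
    exact SimpleFunc.edist_approxOn_le measurable_id (Set.mem_univ x₀) x n
  · have := SimpleFunc.tendsto_approxOn measurable_id (Set.mem_univ x₀) (x := x) (by simp)
    simpa using (tendsto_const_nhds (x := x)).edist this

theorem exists_simpleFunc_lintegral_edist_lt (μ ν : Kernel Ω X) {x₀ : X}
    (hμ : ∫⁻ ω, ∫⁻ x, edist x x₀ ∂(μ ω) ∂P ≠ ∞) (hν : ∫⁻ ω, ∫⁻ x, edist x x₀ ∂(ν ω) ∂P ≠ ∞)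
    {δ : ℝ≥0∞} (hδ : 0 < δ) : ∃ T : SimpleFunc X X,
      ∫⁻ ω, ∫⁻ x, edist x (T x) ∂(μ ω) ∂P < δ ∧ ∫⁻ ω, ∫⁻ x, edist x (T x) ∂(ν ω) ∂P < δ := by
  obtain ⟨n, h⟩ := (((tendsto_lintegral_edist_approxOn μ hμ).eventually_lt_const hδ).and
    ((tendsto_lintegral_edist_approxOn ν hν).eventually_lt_const hδ)).exists
  exact ⟨_, h⟩

variable {μ ν : Kernel Ω X}

theorem wasserstein_one_ne_top [IsFiniteMeasure P] (hμ : μ ∈ kernelSpace 1 P)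
    (hν : ν ∈ kernelSpace 1 P) : wasserstein 1 P μ ν ≠ ∞ := by
  have := hμ.1
  have := hν.1
  obtain ⟨x₀, -⟩ := hμ.2
  let T : SimpleFunc X X := SimpleFunc.const X x₀
  have hle : wasserstein 1 P μ ν ≤ ∫⁻ ω, (∫⁻ x, edist x (T x) ∂(μ ω)
      + ∫⁻ x, edist x (T x) ∂(ν ω)) ∂P := by
    rw [wasserstein_one]
    refine (iInf₂_le _ (prod_mem_couplings μ ν)).trans (lintegral_mono fun ω => ?_)
    simpa [T] using lintegral_edist_le_of_mem_couplings (prod_mem_couplings μ ν) T ω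
  refine ne_top_of_le_ne_top ?_ hle
  rw [lintegral_add_left (measurable_lintegral_edist μ T)]
  exact ENNReal.add_ne_top.2 ⟨lintegral_edist_ne_top_of_mem_kernelSpace hμ x₀,
    lintegral_edist_ne_top_of_mem_kernelSpace hν x₀⟩

theorem ae_integrable_of_mem_lipOne [IsFiniteMeasure P] {κ : Kernel Ω X}
    (hκ : κ ∈ kernelSpace 1 P) {ψ : Ω → X → ℝ} (hψ : ψ ∈ lipOne Ω X) :
    ∀ᵐ ω ∂P, Integrable (ψ ω) (κ ω) := by
  have := hκ.1
  obtain ⟨x₀, -⟩ := hκ.2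
  filter_upwards [ae_lt_top (measurable_lintegral_edist κ (SimpleFunc.const X x₀))
    (lintegral_edist_ne_top_of_mem_kernelSpace hκ x₀)] with ω hω
  exact integrable_of_lipschitzWith (hψ.2 ω) _ hω.ne

theorem integrable_integral_sub_integral [IsFiniteMeasure P] (hμ : μ ∈ kernelSpace 1 P)
    (hν : ν ∈ kernelSpace 1 P) {ψ : Ω → X → ℝ} (hψ : ψ ∈ lipOne Ω X) :
    Integrable (fun ω => ∫ x, ψ ω x ∂(ν ω) - ∫ x, ψ ω x ∂(μ ω)) P := by
  have := hμ.1
  have := hν.1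
  obtain ⟨x₀, -⟩ := hμ.2
  have hm : ∀ κ : Kernel Ω X, IsMarkovKernel κ → StronglyMeasurable fun ω => ∫ x, ψ ω x ∂(κ ω) :=
    fun κ _ => hψ.1.stronglyMeasurable.integral_kernel_prod_right
  refine ⟨((hm ν hν.1).sub (hm μ hμ.1)).aestronglyMeasurable, ?_⟩
  have hπ := prod_mem_couplings μ ν
  let T : SimpleFunc X X := SimpleFunc.const X x₀
  refine lt_of_le_of_lt (lintegral_mono_ae (g := fun ω => ∫⁻ x, edist x (T x) ∂(μ ω)
      + ∫⁻ x, edist x (T x) ∂(ν ω)) ?_) ?_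
  · filter_upwards [ae_integrable_of_mem_lipOne hμ hψ, ae_integrable_of_mem_lipOne hν hψ]
      with ω h1 h2
    refine (enorm_integral_sub_le_of_mem_couplings hπ ω (hψ.2 ω) h1 h2).trans ?_
    simpa [T] using lintegral_edist_le_of_mem_couplings hπ T ω
  · rw [lintegral_add_left (measurable_lintegral_edist μ T)]
    exact (ENNReal.add_ne_top.2 ⟨lintegral_edist_ne_top_of_mem_kernelSpace hμ x₀,
      lintegral_edist_ne_top_of_mem_kernelSpace hν x₀⟩).lt_top

/-- Weak duality. -/
theorem integral_le_wasserstein_one [IsFiniteMeasure P] (hμ : μ ∈ kernelSpace 1 P)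
    (hν : ν ∈ kernelSpace 1 P) {ψ : Ω → X → ℝ} (hψ : ψ ∈ lipOne Ω X) :
    ∫ ω, (∫ x, ψ ω x ∂(ν ω) - ∫ x, ψ ω x ∂(μ ω)) ∂P ≤ (wasserstein 1 P μ ν).toReal := by
  refine (ENNReal.ofReal_le_iff_le_toReal (wasserstein_one_ne_top hμ hν)).1 ?_
  rw [wasserstein_one]
  refine le_iInf₂ fun π hπ => ?_
  refine (Real.ofReal_le_enorm _).trans ((enorm_integral_le_lintegral_enorm _).trans
    (lintegral_mono_ae ?_))
  filter_upwards [ae_integrable_of_mem_lipOne hμ hψ, ae_integrable_of_mem_lipOne hν hψ]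
    with ω h1 h2
  exact enorm_integral_sub_le_of_mem_couplings hπ ω (hψ.2 ω) h1 h2

/-- Strong duality, up to `η`. -/
theorem exists_lipOne_wasserstein_one_le [IsProbabilityMeasure P] (hμ : μ ∈ kernelSpace 1 P)
    (hν : ν ∈ kernelSpace 1 P) {η : ℝ} (hη : 0 < η) :
    ∃ ψ ∈ lipOne Ω X, (wasserstein 1 P μ ν).toReal
      ≤ ∫ ω, (∫ x, ψ ω x ∂(ν ω) - ∫ x, ψ ω x ∂(μ ω)) ∂P + 5 * η := by
  have := hμ.1
  have := hν.1
  obtain ⟨x₀, -⟩ := hμ.2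
  obtain ⟨T, hTμ, hTν⟩ := exists_simpleFunc_lintegral_edist_lt μ ν
    (lintegral_edist_ne_top_of_mem_kernelSpace hμ x₀)
    (lintegral_edist_ne_top_of_mem_kernelSpace hν x₀) (ENNReal.ofReal_pos.2 hη)
  obtain ⟨π, hπ, ψ, hψ, hπψ⟩ := exists_coupling_lipOne_simpleFunc μ ν T hη
  refine ⟨ψ, hψ, ?_⟩
  have hmμ := measurable_lintegral_edist μ T
  have hmν := measurable_lintegral_edist ν T
  set A : Ω → ℝ≥0∞ := fun ω => ∫⁻ x, edist x (T x) ∂(μ ω) with hA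
  set B : Ω → ℝ≥0∞ := fun ω => ∫⁻ x, edist x (T x) ∂(ν ω) with hB
  set H : Ω → ℝ := fun ω => ∫ x, ψ ω x ∂(ν ω) - ∫ x, ψ ω x ∂(μ ω)
  have hAtop : ∫⁻ ω, A ω ∂P ≠ ∞ := hTμ.ne_top
  have hBtop : ∫⁻ ω, B ω ∂P ≠ ∞ := hTν.ne_top
  have hAe := ae_lt_top hmμ hAtop
  have hBe := ae_lt_top hmν hBtop
  have hAi : Integrable (fun ω => (A ω).toReal) P :=
    integrable_toReal_of_lintegral_ne_top hmμ.aemeasurable hAtop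
  have hBi : Integrable (fun ω => (B ω).toReal) P :=
    integrable_toReal_of_lintegral_ne_top hmν.aemeasurable hBtop
  have hA' : ∫ ω, (A ω).toReal ∂P ≤ η := by
    rw [integral_toReal hmμ.aemeasurable hAe]
    exact (ENNReal.toReal_mono ENNReal.ofReal_ne_top hTμ.le).trans_eq (ENNReal.toReal_ofReal hη.le)
  have hB' : ∫ ω, (B ω).toReal ∂P ≤ η := by
    rw [integral_toReal hmν.aemeasurable hBe]
    exact (ENNReal.toReal_mono ENNReal.ofReal_ne_top hTν.le).trans_eq (ENNReal.toReal_ofReal hη.le)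
  have hHi : Integrable H P := integrable_integral_sub_integral hμ hν hψ
  -- Passing from `ψ ω ∘ T` back to `ψ ω` costs at most `A ω + B ω`, so `G` bounds the quantized
  -- transport cost by the true dual value.
  let G : Ω → ℝ := fun ω => H ω + (A ω).toReal + (B ω).toReal + η
  have hGi : Integrable G P := ((hHi.add hAi).add hBi).add (integrable_const η)
  have hG : ∀ᵐ ω ∂P, ∫ x, ψ ω (T x) ∂(ν ω) - ∫ x, ψ ω (T x) ∂(μ ω) + η ≤ G ω := by
    filter_upwards [hAe, hBe, ae_integrable_of_mem_lipOne hμ hψ, ae_integrable_of_mem_lipOne hν hψ]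
      with ω ha hb h1 h2
    have e1 := abs_le.1 (abs_integral_sub_integral_comp_le (hψ.2 ω) h1 T ha.ne)
    have e2 := abs_le.1 (abs_integral_sub_integral_comp_le (hψ.2 ω) h2 T hb.ne)
    simp only [G, H, hA, hB]
    linarith [e1.2, e2.1]
  -- Nonnegativity turns the lower integral of `ENNReal.ofReal ∘ G` into a Bochner integral.
  have hG0 : 0 ≤ᵐ[P] G := by
    filter_upwards [hG] with ω h
    exact (hπψ ω).1.trans h
  have hGint : ∫ ω, G ω ∂P ≤ ∫ ω, H ω ∂P + 3 * η := by
    have : ∫ ω, G ω ∂P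
        = ∫ ω, H ω ∂P + ∫ ω, (A ω).toReal ∂P + ∫ ω, (B ω).toReal ∂P + η := by
      simp only [G]
      have h1 : Integrable (fun ω => H ω + (A ω).toReal) P := hHi.add hAi
      have h2 : Integrable (fun ω => H ω + (A ω).toReal + (B ω).toReal) P := h1.add hBi
      rw [integral_add h2 (integrable_const η), integral_add h1 hBi, integral_add hHi hAi]
      simp
    linarith
  -- Quantizing the cost adds another `2 * η` to the `3 * η` contained in `G`: in total `5 * η`.
  have hW : wasserstein 1 P μ ν ≤ ENNReal.ofReal (η + η + ∫ ω, G ω ∂P) := by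
    rw [wasserstein_one]
    refine (iInf₂_le π hπ).trans ?_
    calc ∫⁻ ω, ∫⁻ z, edist z.1 z.2 ∂(π ω) ∂P
        ≤ ∫⁻ ω, (A ω + B ω + ENNReal.ofReal (G ω)) ∂P := by
          refine lintegral_mono_ae ?_
          filter_upwards [hG] with ω h
          refine (lintegral_edist_le_of_mem_couplings hπ T ω).trans ?_
          exact add_le_add le_rfl ((hπψ ω).2.trans (ENNReal.ofReal_le_ofReal h))
      _ = ∫⁻ ω, A ω ∂P + ∫⁻ ω, B ω ∂P + ENNReal.ofReal (∫ ω, G ω ∂P) := by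
          rw [lintegral_add_left (by fun_prop), lintegral_add_left hmμ,
            ofReal_integral_eq_lintegral_ofReal hGi hG0]
      _ ≤ ENNReal.ofReal η + ENNReal.ofReal η + ENNReal.ofReal (∫ ω, G ω ∂P) := by gcongr
      _ = _ := by
          rw [← ENNReal.ofReal_add hη.le hη.le, ← ENNReal.ofReal_add (add_pos hη hη).le
            (integral_nonneg_of_ae hG0)]
  have hG1 := integral_nonneg_of_ae hG0
  have := ENNReal.toReal_le_of_le_ofReal (by positivity) hW
  linarith

end Main

end KernelTransport

theorem theorem4p2 {Ω X : Type*} [MeasurableSpace Ω] (P : Measure Ω) [IsProbabilityMeasure P]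
    [MetricSpace X] [PolishSpace X] [MeasurableSpace X] [BorelSpace X]
    (μ ν : Kernel Ω X)
    (hμ : μ ∈ KernelTransport.kernelSpace 1 P) (hν : ν ∈ KernelTransport.kernelSpace 1 P) :
    -- the distance is finite
    KernelTransport.wasserstein 1 P μ ν ≠ ∞ ∧
    -- the integrals and the expectation under the supremum all exist
    (∀ ψ ∈ KernelTransport.lipOne Ω X,
      (∀ᵐ ω ∂P, Integrable (ψ ω) (μ ω) ∧ Integrable (ψ ω) (ν ω)) ∧
      Integrable (fun ω => ∫ x, ψ ω x ∂(ν ω) - ∫ x, ψ ω x ∂(μ ω)) P) ∧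
    -- the distance is their supremum
    IsLUB {r : ℝ | ∃ ψ ∈ KernelTransport.lipOne Ω X,
        r = ∫ ω, (∫ x, ψ ω x ∂(ν ω) - ∫ x, ψ ω x ∂(μ ω)) ∂P}
      (KernelTransport.wasserstein 1 P μ ν).toReal := by
  refine ⟨KernelTransport.wasserstein_one_ne_top hμ hν, fun ψ hψ =>
    ⟨(KernelTransport.ae_integrable_of_mem_lipOne hμ hψ).and
      (KernelTransport.ae_integrable_of_mem_lipOne hν hψ),
    KernelTransport.integrable_integral_sub_integral hμ hν hψ⟩, ?_, fun r hr => ?_⟩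
  · rintro _ ⟨ψ, hψ, rfl⟩
    exact KernelTransport.integral_le_wasserstein_one hμ hν hψ
  · refine le_of_forall_pos_le_add fun ε hε => ?_
    obtain ⟨ψ, hψ, hle⟩ := KernelTransport.exists_lipOne_wasserstein_one_le hμ hν
      (show 0 < ε / 5 by positivity)
    have := hr ⟨ψ, hψ, rfl⟩
    linarith
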